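/- **Corollary (A Length gap).** For a Boolean algebra $B$ let $\mathrm{Length}^+(B)=\sup\{\theta^+ : \text{there is } A\subseteq B \text{ with } |A|=\theta \text{ that is linearly ordered by } <_B\}$. An ultrafilter $D$ on a set $I$ is *regular* if there are finite sets $W_i\subseteq I$ $(i\in I)$ such that $\{i\in I:\zeta\in W_i\}\in D$ for every $\zeta\in I$. For cardinals $\mu_i$ let $\prod_{i\in I}\mu_i/D$ denote the cardinality of the ultraproduct of sets of cardinalities $\mu_i$. Let $\kappa,\lambda,\partial$ be cardinals with $\lambda>\mathrm{cf}(\lambda)=\partial$ and $\kappa^+\le\partial\le 2^\kappa$, and let $D$ be a regular ultrafilter on a set $I$ of cardinality $\kappa$. Then there is a family $\langle B_i:i\in I\rangle$ of Boolean algebras such that, simultaneously: 1. $\mathrm{Length}^+(B_i)\le\lambda$ for every $i\in I$; 2. $\mathrm{Length}^+\bigl(\prod_{i\in I}B_i/D\bigr)\ge\lambda^+$, and equality holds if $\lambda^\kappa=\lambda$; 3. $\prod_{i\in I}\mathrm{Length}^+(B_i)/D<\mathrm{Length}^+\bigl(\prod_{i\in I}B_i/D\bigr)$. -/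

import Mathlib

open Cardinal

universe u

/-- An ultrafilter `D` on `I` is regular if there are finite sets `W i ⊆ I` (`i ∈ I`) such that
`{i | ζ ∈ W i} ∈ D` for every `ζ ∈ I`. -/
def IsRegularUltrafilter {I : Type u} (D : Ultrafilter I) : Prop :=
  ∃ W : I → Finset I, ∀ ζ : I, {i : I | ζ ∈ W i} ∈ D

/-- The ultraproduct `∏ B i / D` of Boolean algebras (Mathlib's `Filter.Product`, the quotient of
`∀ i, B i` by equality on a set in `D`), with the operations induced from the coordinates and
`[f] ≤ [g]` if and only if `f i ≤ g i` for `D`-almost all `i`. -/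
instance ultraproductBooleanAlgebra {I : Type u} (D : Ultrafilter I) (B : I → Type u)
    [∀ i, BooleanAlgebra (B i)] : BooleanAlgebra ((D : Filter I).Product B) where
  le := fun x y => Quotient.liftOn₂' x y (fun f g => ∀ᶠ i in (D : Filter I), f i ≤ g i)
    (fun f g f' g' hf hg => propext <| Filter.eventually_congr <| by
      filter_upwards [hf, hg] with i h₁ h₂
      rw [h₁, h₂])
  le_refl := by
    rintro ⟨f⟩
    exact Filter.Eventually.of_forall fun i => le_rfl
  le_trans := by
    rintro ⟨f⟩ ⟨g⟩ ⟨h⟩ hfg hgh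
    exact Filter.Eventually.mp hfg (Filter.Eventually.mono hgh fun i h₂ h₁ => le_trans h₁ h₂)
  le_antisymm := by
    rintro ⟨f⟩ ⟨g⟩ hfg hgf
    exact Quotient.sound'
      (Filter.Eventually.mp hfg (Filter.Eventually.mono hgf fun i h₂ h₁ => le_antisymm h₁ h₂))
  sup := Quotient.map₂' (fun f g i => f i ⊔ g i) (fun f f' hf g g' hg => by
    filter_upwards [hf, hg] with i h₁ h₂
    rw [h₁, h₂])
  inf := Quotient.map₂' (fun f g i => f i ⊓ g i) (fun f f' hf g g' hg => by
    filter_upwards [hf, hg] with i h₁ h₂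
    rw [h₁, h₂])
  compl := Quotient.map' (fun f i => (f i)ᶜ) (fun f f' hf => by
    filter_upwards [hf] with i h₁
    rw [h₁])
  top := Quotient.mk'' fun _ => ⊤
  bot := Quotient.mk'' fun _ => ⊥
  le_sup_left := by
    rintro ⟨f⟩ ⟨g⟩
    exact Filter.Eventually.of_forall fun i => le_sup_left
  le_sup_right := by
    rintro ⟨f⟩ ⟨g⟩
    exact Filter.Eventually.of_forall fun i => le_sup_right
  sup_le := by
    rintro ⟨f⟩ ⟨g⟩ ⟨h⟩ hfh hgh
    exact Filter.Eventually.mp hfh (Filter.Eventually.mono hgh fun i h₂ h₁ => sup_le h₁ h₂)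
  inf_le_left := by
    rintro ⟨f⟩ ⟨g⟩
    exact Filter.Eventually.of_forall fun i => inf_le_left
  inf_le_right := by
    rintro ⟨f⟩ ⟨g⟩
    exact Filter.Eventually.of_forall fun i => inf_le_right
  le_inf := by
    rintro ⟨f⟩ ⟨g⟩ ⟨h⟩ hfg hfh
    exact Filter.Eventually.mp hfg (Filter.Eventually.mono hfh fun i h₂ h₁ => le_inf h₁ h₂)
  le_sup_inf := by
    rintro ⟨f⟩ ⟨g⟩ ⟨h⟩
    exact Filter.Eventually.of_forall fun i => le_sup_inf
  le_top := by
    rintro ⟨f⟩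
    exact Filter.Eventually.of_forall fun i => le_top
  bot_le := by
    rintro ⟨f⟩
    exact Filter.Eventually.of_forall fun i => bot_le
  inf_compl_le_bot := by
    rintro ⟨f⟩
    exact Filter.Eventually.of_forall fun i => inf_compl_self (f i) |>.le
  top_le_sup_compl := by
    rintro ⟨f⟩
    exact Filter.Eventually.of_forall fun i => sup_compl_eq_top (x := f i) |>.ge

/-- `Length⁺(B)`: the supremum of the cardinals `θ⁺` such that `B` has a linearly ordered subset
of cardinality `θ`. -/
noncomputable def lengthPlus (B : Type u) [BooleanAlgebra B] : Cardinal.{u} :=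
  sSup {c : Cardinal.{u} | ∃ A : Set B, IsChain (· ≤ ·) A ∧ c = Order.succ #A}

/-- The supremum in `lengthPlus` is over a bounded set. -/
theorem lengthPlus_bddAbove (B : Type u) [BooleanAlgebra B] :
    BddAbove {c : Cardinal.{u} | ∃ A : Set B, IsChain (· ≤ ·) A ∧ c = Order.succ #A} := by
  refine ⟨Order.succ #B, ?_⟩
  rintro c ⟨A, -, rfl⟩
  exact Order.succ_le_succ (mk_set_le A)

/-- The ultraproduct `∏ c i / D` of cardinals: the cardinality of the ultraproduct of sets of
cardinalities `c i`. -/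
noncomputable def cardinalUltraproduct {I : Type u} (D : Ultrafilter I)
    (c : I → Cardinal.{u}) : Cardinal.{u} :=
  #((D : Filter I).Product fun i => (c i).out)

/-! ### Interval algebras of linear orders. -/

section IntervalAlgebra

/-! Take `S` cofinal in `lam` with `#S = del`, and for `a` in `S` an algebra `E a` of size below
`lam` containing a chain `T a` that has room for the initial segment below `a`. As `del ≤ 2 ^ κ`,
the indices `a` are named by distinct sets `x a ⊆ I`. At `i` only the trace of `x a` on the finite
set `W i` is visible; it splits `S` into finitely many classes, and `B i` is the weak product of the
`E a` over these classes.

A chain in `B i` is small: up to countably many codes its elements vary only on a fixed finite set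
of coordinates, and `lam` has uncountable cofinality (`mk_chain_weakProduct_lt`).

In the ultraproduct, regularity separates the classes of distinct indices almost everywhere, so the
chains line up one after another (`exists_chain_ultraproduct`). Regularity also makes each
contribute `#(T a) ^ κ` elements (`exists_encoding`). Since `κ < cf lam`, the total is at least `lam
^ κ` (`power_le_mk_sigma`), whereas the ultraproduct of the lengths is at most `lam ^ κ`. -/

/-- An infinite linear order `T` embeds strictly monotonically, avoiding `⊤`, into a Boolean
algebra of cardinality at most `#T`. -/
theorem exists_booleanAlgebra_strictMono (T : Type u) [LinearOrder T] [Infinite T] :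
    ∃ (E : Type u) (_ : BooleanAlgebra E) (f : T → E),
      StrictMono f ∧ (∀ t, f t ≠ ⊤) ∧ #E ≤ #T := by
  classical
  -- The strict inequality gives `ind t t = 0`, which keeps the image away from `⊤`.
  let ind : T → T → ZMod 2 := fun t y => if y < t then 1 else 0
  let A : Subalgebra (ZMod 2) (T → ZMod 2) := Algebra.adjoin (ZMod 2) (Set.range ind)
  have hmul : ∀ z : ZMod 2, z * z = z := by decide
  let _ : BooleanRing A :=
    { (inferInstance : Ring A) with
      isIdempotentElem := fun a => Subtype.ext (funext fun y => hmul _) }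
  let f : T → A := fun t => ⟨ind t, Algebra.subset_adjoin ⟨t, rfl⟩⟩
  refine ⟨AsBoolAlg A, inferInstance, fun t => toBoolAlg (f t), ?_, ?_, ?_⟩
  · intro s t hst
    refine lt_of_le_of_ne ?_ ?_
    · refine inf_eq_left.1 ?_
      rw [← toBoolAlg_mul]
      congr 1
      refine Subtype.ext (funext fun y => ?_)
      change ind s y * ind t y = ind s y
      by_cases hy : y < s
      · simp [ind, hy, hy.trans hst]
      · simp [ind, hy]
    · intro h
      have h1 : ind s s = ind t s := congrFun (congrArg Subtype.val (toBoolAlg_inj.1 h)) s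
      simp [ind, hst] at h1
  · intro t h
    have h1 : ind t t = 1 :=
      congrFun (congrArg Subtype.val (toBoolAlg_inj.1 (h.trans toBoolAlg_one.symm))) t
    simp [ind] at h1
  · have h := Algebra.lift_cardinalMk_adjoin_le (ZMod 2) (Set.range ind)
    change #A ≤ #T
    simp only [lift_uzero] at h
    refine h.trans (max_le (max_le ?_ mk_range_le) (aleph0_le_mk T))
    exact (Cardinal.lift_le_aleph0.2 (mk_le_aleph0)).trans (aleph0_le_mk T)

end IntervalAlgebra

/-! ### Weak products: cardinality and chains. -/

section WeakProduct

open Classical in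
/-- The element of `∀ a, E a` that is `⊤` on the classes in `K` and `⊥` on the others. -/
noncomputable def classElement {S J : Type u} (E : S → Type u) [∀ a, BooleanAlgebra (E a)]
    (cls : S → J) (K : Set J) (a : S) : E a :=
  if cls a ∈ K then ⊤ else ⊥

variable {S J : Type u} {E : S → Type u} [∀ a, BooleanAlgebra (E a)]

/-- The Boolean subalgebra of `∀ a, E a` of the elements that, off a finite set, are constantly
`⊤` or constantly `⊥` on each class. -/
noncomputable def weakProduct (E : S → Type u) [∀ a, BooleanAlgebra (E a)] (cls : S → J) :
    BooleanSubalgebra (∀ a, E a) where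
  carrier := {b | ∃ K : Set J, {a | b a ≠ classElement E cls K a}.Finite}
  supClosed' := by
    rintro b ⟨K, hK⟩ c ⟨M, hM⟩
    refine ⟨K ∪ M, (hK.union hM).subset fun a ha => ?_⟩
    by_contra h
    simp only [Set.mem_union, Set.mem_ofPred_eq, not_or, not_not] at h
    refine ha ?_
    rw [Pi.sup_apply, h.1, h.2]
    by_cases h1 : cls a ∈ K <;> by_cases h2 : cls a ∈ M <;> simp [classElement, h1, h2]
  infClosed' := by
    rintro b ⟨K, hK⟩ c ⟨M, hM⟩
    refine ⟨K ∩ M, (hK.union hM).subset fun a ha => ?_⟩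
    by_contra h
    simp only [Set.mem_union, Set.mem_ofPred_eq, not_or, not_not] at h
    refine ha ?_
    rw [Pi.inf_apply, h.1, h.2]
    by_cases h1 : cls a ∈ K <;> by_cases h2 : cls a ∈ M <;> simp [classElement, h1, h2]
  compl_mem' := by
    rintro b ⟨K, hK⟩
    refine ⟨Kᶜ, hK.subset fun a ha h => ha ?_⟩
    rw [Pi.compl_apply, h]
    by_cases h1 : cls a ∈ K <;> simp [classElement, h1]
  bot_mem' := ⟨∅, by simp [classElement]⟩

/-- A product of finitely many sets of cardinality less than an uncountable `c` has cardinality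
less than `c`. -/
theorem mk_pi_finset_lt {E : S → Type u} {c : Cardinal.{u}} (hc : ℵ₀ < c) (hE : ∀ a, #(E a) < c)
    (F : Finset S) : #(∀ a : F, E a) < c := by
  have hm : F.sup (fun a => #(E a)) < c :=
    (Finset.sup_lt_iff (by simpa using aleph0_pos.trans hc)).2 fun a _ => hE a
  refine lt_of_le_of_lt ?_ (max_lt hm hc)
  rw [mk_pi]
  refine (prod_le_prod _ (fun _ => F.sup (fun a => #(E a))) fun a =>
    Finset.le_sup (f := fun a => #(E a)) a.2).trans ?_
  rw [prod_const', mk_coe_finset]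
  exact power_nat_le_max

/-- A set with a map to a countable type whose fibers have cardinality less than `c` has
cardinality less than `c`, if `c` has uncountable cofinality. -/
theorem mk_lt_of_fibers_lt {α Q : Type u} [Countable Q] (g : α → Q) {c : Cardinal.{u}}
    (hc : ℵ₀ < c.ord.cof) (h : ∀ q, #{x // g x = q} < c) : #α < c := by
  have hc' : ℵ₀ < c := hc.trans_le (Ordinal.cof_ord_le c)
  rw [← mk_congr (Equiv.sigmaFiberEquiv g), mk_sigma]
  refine (sum_le_mk_mul_iSup _).trans_lt (mul_lt_of_lt hc'.le (mk_le_aleph0.trans_lt hc') ?_)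
  exact iSup_lt_of_lt_cof_ord (mk_le_aleph0.trans_lt hc) h

/-- An element is determined by its set `K` of classes and its values on the finite exceptional set.
-/
theorem mk_weakProduct_le [Finite J] {cls : S → J} {c : Cardinal.{u}} (hc : ℵ₀ < c)
    (hS : #S ≤ c) (hE : ∀ a, #(E a) < c) : #(weakProduct E cls) ≤ c := by
  choose K hK using fun b : weakProduct E cls => b.2
  let code : weakProduct E cls → Set J × Σ F : Finset S, ∀ a : F, E a :=
    fun b => (K b, ⟨(hK b).toFinset, fun a => b.1 a⟩)
  have hcode : Function.Injective code := by
    intro b b' h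
    have h1 : K b = K b' := congrArg Prod.fst h
    have h2 := congrArg Prod.snd h
    refine Subtype.ext (funext fun a => ?_)
    by_cases ha : b.1 a = classElement E cls (K b) a
    · by_cases ha' : b'.1 a = classElement E cls (K b') a
      · rw [ha, ha', h1]
      · have h3 := (Sigma.ext_iff.1 h2).1
        have : a ∈ (hK b).toFinset := by
          change (hK b).toFinset = (hK b').toFinset at h3
          rw [h3]; simpa using ha'
        exact absurd ha (by simpa using this)
    · have h3 : ∀ p q : (Σ F : Finset S, ∀ a : F, E a), p = q → ∀ (hp : a ∈ p.1) (hq : a ∈ q.1),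
          p.2 ⟨a, hp⟩ = q.2 ⟨a, hq⟩ := by rintro p _ rfl _ _; rfl
      have hm : a ∈ (hK b).toFinset := by simpa using ha
      refine h3 _ _ h2 hm ?_
      have h4 : (hK b).toFinset = (hK b').toFinset := (Sigma.ext_iff.1 h2).1
      have h5 : a ∈ (hK b').toFinset := h4 ▸ hm
      exact h5
  refine (mk_le_of_injective hcode).trans ?_
  rw [mk_prod, lift_id, lift_id, mk_sigma]
  refine mul_le_of_le hc.le (mk_le_aleph0.trans hc.le) ?_
  refine (sum_le_sum _ (fun _ => c) fun F => (mk_pi_finset_lt hc hE F).le).trans ?_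
  rw [sum_const']
  refine mul_le_of_le hc.le ?_ le_rfl
  rcases finite_or_infinite S with h | h
  · exact mk_le_aleph0.trans hc.le
  · rwa [mk_finset_of_infinite]

/-- Code an element by `K` and the numbers of its exceptions to `⊥` and to `⊤`. Along a chain with
`K` fixed, the former set grows and the latter shrinks, so equal finite sizes force equal sets. Each
fiber of the code thus embeds in a finite product of the `E a`. -/
theorem mk_chain_weakProduct_lt [Finite J] {cls : S → J} {c : Cardinal.{u}}
    (hc : ℵ₀ < c.ord.cof) (hE : ∀ a, #(E a) < c) (A : Set (weakProduct E cls))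
    (hA : IsChain (· ≤ ·) A) : #A < c := by
  have hc' : ℵ₀ < c := hc.trans_le (Ordinal.cof_ord_le c)
  choose K hK using fun b : weakProduct E cls => b.2
  let P : weakProduct E cls → Set S := fun b => {a | cls a ∉ K b ∧ b.1 a ≠ ⊥}
  let N : weakProduct E cls → Set S := fun b => {a | cls a ∈ K b ∧ b.1 a ≠ ⊤}
  have hP : ∀ b, (P b).Finite := fun b => (hK b).subset fun a ha => by
    simpa [classElement, ha.1] using ha.2
  have hN : ∀ b, (N b).Finite := fun b => (hK b).subset fun a ha => by
    simpa [classElement, ha.1] using ha.2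
  let g : A → Set J × ULift.{u} (ℕ × ℕ) := fun b => (K b, ⟨(P b).ncard, (N b).ncard⟩)
  refine mk_lt_of_fibers_lt g hc fun q => ?_
  rcases isEmpty_or_nonempty {x // g x = q} with he | ⟨⟨b₀, hb₀⟩⟩
  · rw [mk_eq_zero]
    exact aleph0_pos.trans hc'
  have key : ∀ b b' : A, b.1 ≤ b'.1 → g b = g b' → P b = P b' ∧ N b = N b' := by
    intro b b' hle h
    have h1 : K b = K b' := congrArg Prod.fst h
    have h2 : (P b).ncard = (P b').ncard := congrArg (fun z => z.2.down.1) h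
    have h3 : (N b).ncard = (N b').ncard := congrArg (fun z => z.2.down.2) h
    have hle' : ∀ a, b.1.1 a ≤ b'.1.1 a := hle
    have hPs : P b ⊆ P b' := by
      rintro a ⟨ha, ha'⟩
      have : cls a ∉ K b' ∧ b'.1.1 a ≠ ⊥ :=
        ⟨h1 ▸ ha, fun h0 => ha' (le_bot_iff.1 (h0 ▸ hle' a))⟩
      exact this
    have hNs : N b' ⊆ N b := by
      rintro a ⟨ha, ha'⟩
      have : cls a ∈ K b ∧ b.1.1 a ≠ ⊤ :=
        ⟨h1 ▸ ha, fun h0 => ha' (top_le_iff.1 (h0 ▸ hle' a))⟩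
      exact this
    exact ⟨Set.eq_of_subset_of_ncard_le hPs h2.ge (hP _),
      (Set.eq_of_subset_of_ncard_le hNs h3.le (hN _)).symm⟩
  have key' : ∀ b : {x // g x = q}, K b.1 = K b₀ ∧ P b.1 = P b₀ ∧ N b.1 = N b₀ := by
    rintro ⟨b, hb⟩
    have h : g b = g b₀ := hb.trans hb₀.symm
    refine ⟨congrArg Prod.fst h, ?_⟩
    rcases hA.total b.2 b₀.2 with hle | hle
    · exact key b b₀ hle h
    · exact (key b₀ b hle h.symm).imp Eq.symm Eq.symm
  let F : Finset S := ((hP b₀).union (hN b₀)).toFinset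
  refine (mk_le_of_injective (β := ∀ a : F, E a)
    (f := fun b : {x // g x = q} => fun a : F => b.1.1.1 a) ?_).trans_lt (mk_pi_finset_lt hc' hE F)
  intro b b' h
  refine Subtype.ext (Subtype.ext (Subtype.ext (funext fun a => ?_)))
  by_cases ha : a ∈ F
  · exact congrFun h ⟨a, ha⟩
  · have hval : ∀ d : {x // g x = q}, d.1.1.1 a = classElement E cls (K b₀) a := by
      intro d
      obtain ⟨h1, h2, h3⟩ := key' d
      have ha' : a ∉ P d.1 ∧ a ∉ N d.1 := by
        rw [h2, h3]; simpa [F, not_or] using ha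
      rw [← h1]
      by_cases hk : cls a ∈ K d.1
      · simpa [classElement, hk, N] using ha'.2
      · simpa [classElement, hk, P] using ha'.1
    rw [hval b, hval b']

end WeakProduct

/-! ### Long chains in the ultraproduct. -/

section Chain

variable {S J : Type u} {E : S → Type u} [∀ a, BooleanAlgebra (E a)]

open Classical in
/-- The element of the weak product that is `⊤` on the classes below that of `a`, `⊥` on the
classes above it and on the other indices in the class of `a`, and `e` at `a`. -/
noncomputable def cutElement [LinearOrder J] (cls : S → J) (a : S) (e : E a) :
    weakProduct E cls :=
  ⟨Function.update (classElement E cls (Set.Iio (cls a))) a e, Set.Iio (cls a),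
    (Set.finite_singleton a).subset fun a' h => by
      by_contra hne
      exact h (Function.update_of_ne hne _ _)⟩

variable [LinearOrder J] {cls : S → J}

/-- Strictness is visible at `a`, where the larger element is `⊤` and the smaller is `e ≠ ⊤`. -/
theorem cutElement_lt_of_class_lt {a a' : S} (h : cls a < cls a') {e : E a} {e' : E a'}
    (he : e ≠ ⊤) : cutElement cls a e < cutElement cls a' e' := by
  classical
  have hne : a ≠ a' := fun h' => h.ne (congrArg cls h')
  have htop : (cutElement cls a' e').1 a = ⊤ := by
    simp [cutElement, classElement, Function.update_of_ne hne, h]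
  refine lt_of_le_of_ne (fun b => ?_) fun h' => he ?_
  · change (cutElement cls a e).1 b ≤ (cutElement cls a' e').1 b
    by_cases hba : b = a
    · subst hba
      rw [htop]
      exact le_top
    · by_cases hb : cls b < cls a
      · have hne' : b ≠ a' := fun h' => (hb.trans h).ne (congrArg cls h')
        simp [cutElement, classElement, Function.update_of_ne hne', hb.trans h]
      · simp [cutElement, classElement, Function.update_of_ne hba, hb]
  · rw [← h'] at htop
    simpa [cutElement] using htop

theorem cutElement_lt_of_lt {a : S} {e e' : E a} (h : e < e') :
    cutElement cls a e < cutElement cls a e' := by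
  classical
  refine lt_of_le_of_ne (fun b => ?_) fun h' => h.ne ?_
  · exact update_le_update_iff.2 ⟨h.le, fun _ _ => le_rfl⟩ b
  · simpa [cutElement] using congrFun (congrArg Subtype.val h') a

/-- If the classes of any two indices differ almost everywhere, then the ultraproduct of the weak
products contains a chain of the cardinality of `Σ a, I → T a`. -/
theorem exists_chain_ultraproduct {I : Type u} (D : Ultrafilter I) {J : I → Type u}
    [∀ i, LinearOrder (J i)] (cls : ∀ i, S → J i)
    (hcls : ∀ a a', a ≠ a' → ∀ᶠ i in D, cls i a ≠ cls i a')
    {T : S → Type u} [∀ a, LinearOrder (T a)] (f : ∀ a, T a → E a) (hf : ∀ a, StrictMono (f a))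
    (hf' : ∀ a t, f a t ≠ ⊤) (enc : ∀ a, (I → T a) → I → T a)
    (henc : ∀ a g g', g ≠ g' → ∀ᶠ i in D, enc a g i ≠ enc a g' i) :
    ∃ A : Set ((D : Filter I).Product fun i => weakProduct E (cls i)),
      IsChain (· ≤ ·) A ∧ #A = #(Σ a, I → T a) := by
  let el : (Σ a, I → T a) → ∀ i, weakProduct E (cls i) :=
    fun p i => cutElement (cls i) p.1 (f p.1 (enc p.1 p.2 i))
  have key : ∀ p q, p ≠ q → (∀ᶠ i in D, el p i < el q i) ∨ ∀ᶠ i in D, el q i < el p i := by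
    rintro ⟨a, g⟩ ⟨a', g'⟩ hpq
    -- The ultrafilter decides the direction, so being comparable and distinct almost everywhere
    -- suffices.
    rw [← Ultrafilter.eventually_or]
    by_cases ha : a = a'
    · subst ha
      filter_upwards [henc a g g' fun h => hpq (h ▸ rfl)] with i hi
      exact hi.lt_or_gt.imp (fun h => cutElement_lt_of_lt (hf a h))
        fun h => cutElement_lt_of_lt (hf a h)
    · filter_upwards [hcls a a' ha] with i hi
      exact hi.lt_or_gt.imp (fun h => cutElement_lt_of_class_lt h (hf' _ _))
        fun h => cutElement_lt_of_class_lt h (hf' _ _)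
  let Ψ : (Σ a, I → T a) → (D : Filter I).Product fun i => weakProduct E (cls i) :=
    fun p => Quotient.mk'' (el p)
  have hΨ : Function.Injective Ψ := by
    intro p q h
    by_contra hpq
    have h' : ∀ᶠ i in D, el p i = el q i := Quotient.exact h
    rcases key p q hpq with h1 | h1
    · obtain ⟨i, h2, h3⟩ := (h'.and h1).exists
      exact h3.ne h2
    · obtain ⟨i, h2, h3⟩ := (h'.and h1).exists
      exact h3.ne' h2
  refine ⟨Set.range Ψ, ?_, mk_range_eq Ψ hΨ⟩
  rintro _ ⟨p, rfl⟩ _ ⟨q, rfl⟩ hne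
  exact (key p q fun h => hne (h ▸ rfl)).imp
    (fun h => h.mono fun _ => le_of_lt) fun h => h.mono fun _ => le_of_lt

end Chain

/-! ### Consequences of regularity. -/

section Regular

variable {I : Type u} {D : Ultrafilter I} {W : I → Finset I}

theorem eventually_restrict_ne (hW : ∀ ζ : I, {i : I | ζ ∈ W i} ∈ D) {T : Type*} {g g' : I → T}
    (h : g ≠ g') : ∀ᶠ i in D, (fun w : W i => g w) ≠ fun w : W i => g' w := by
  obtain ⟨ζ, hζ⟩ := Function.ne_iff.1 h
  filter_upwards [hW ζ] with i hi h'
  exact hζ (congrFun h' ⟨ζ, hi⟩)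

/-- For a regular ultrafilter and an infinite set `T`, the functions `I → T` can be encoded by
functions that are pairwise different almost everywhere. -/
theorem exists_encoding (hW : ∀ ζ : I, {i : I | ζ ∈ W i} ∈ D) (T : Type u) [Infinite T] :
    ∃ enc : (I → T) → I → T, ∀ g g', g ≠ g' → ∀ᶠ i in D, enc g i ≠ enc g' i := by
  -- Finite powers of an infinite set do not increase its cardinality.
  have h : ∀ i, Nonempty ((W i → T) ↪ T) := fun i => by
    rw [← Cardinal.le_def, mk_arrow, lift_id, lift_id, mk_coe_finset]
    exact power_nat_le (aleph0_le_mk T)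
  let e := fun i => (h i).some
  refine ⟨fun g i => e i fun w => g w, fun g g' hg => ?_⟩
  filter_upwards [eventually_restrict_ne hW hg] with i hi h'
  exact hi ((e i).injective h')

end Regular

/-! ### Cardinal bounds and the main theorem. -/

/-- If `κ` is less than the cofinality of `c`, then `c ^ κ` is at most the sum of the `κ`-th powers
of the cardinalities of initial segments over a cofinal set. -/
theorem power_le_mk_sigma {I L : Type u} [LinearOrder L] [WellFoundedLT L]
    (hI : #I < Order.cof L) {S : Set L} (hS : IsCofinal S) {T : S → Type u}
    (ι : ∀ a : S, Set.Iio a.1 ↪ T a) : #L ^ #I ≤ #(Σ a : S, I → T a) := by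
  -- A range of size below the cofinality is bounded, so every `h` maps into a single initial
  -- segment.
  have hb : ∀ h : I → L, ∃ a : S, ∀ i, h i < a.1 := by
    intro h
    have h1 : ¬ IsCofinal (Set.range h) := fun hc =>
      ((Order.cof_le hc).trans mk_range_le).not_gt hI
    rw [not_isCofinal_iff] at h1
    obtain ⟨x, hx⟩ := h1
    obtain ⟨y, hy, hxy⟩ := hS x
    exact ⟨⟨y, hy⟩, fun i => (hx _ ⟨i, rfl⟩).trans_le hxy⟩
  choose a ha using hb
  rw [power_def]
  refine mk_le_of_injective (f := fun h => ⟨a h, fun i => ι (a h) ⟨h i, ha h i⟩⟩) fun h h' hh => ?_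
  have h3 : ∀ p q : (Σ a : S, I → T a), p = q → ∀ x y : I → L, (∀ i, ∃ hx, p.2 i = ι p.1 ⟨x i, hx⟩) →
      (∀ i, ∃ hy, q.2 i = ι q.1 ⟨y i, hy⟩) → x = y := by
    rintro p _ rfl x y hx hy
    funext i
    obtain ⟨h1, h2⟩ := hx i
    obtain ⟨h3, h4⟩ := hy i
    exact congrArg Subtype.val ((ι p.1).injective (h2.symm.trans h4))
  exact h3 _ _ hh h h' (fun i => ⟨_, rfl⟩) fun i => ⟨_, rfl⟩

theorem mk_ultraproduct_le {I : Type u} (D : Ultrafilter I) {B : I → Type u} {c : Cardinal.{u}}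
    (h : ∀ i, #(B i) ≤ c) : #((D : Filter I).Product B) ≤ c ^ #I := by
  refine (mk_le_of_surjective Quotient.mk''_surjective).trans ?_
  rw [mk_pi, ← prod_const']
  exact prod_le_prod _ _ h

theorem succ_mk_le_lengthPlus {B : Type u} [BooleanAlgebra B] {A : Set B}
    (hA : IsChain (· ≤ ·) A) : Order.succ #A ≤ lengthPlus B :=
  le_csSup (lengthPlus_bddAbove B) ⟨A, hA, rfl⟩

theorem lengthPlus_le {B : Type u} [BooleanAlgebra B] {c : Cardinal.{u}}
    (h : ∀ A : Set B, IsChain (· ≤ ·) A → #A < c) : lengthPlus B ≤ c := by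
  refine csSup_le' ?_
  rintro _ ⟨A, hA, rfl⟩
  exact Order.succ_le_of_lt (h A hA)

theorem mainTheorem2 (κ lam del : Cardinal.{u}) (hcof : lam.ord.cof = del) (hsing : del < lam)
    (hκdel : Order.succ κ ≤ del) (hdel : del ≤ 2 ^ κ)
    (I : Type u) (hI : #I = κ) (D : Ultrafilter I) (hD : IsRegularUltrafilter D) :
    ∃ (B : I → Type u) (_ : ∀ i, BooleanAlgebra (B i)),
      (∀ i, lengthPlus (B i) ≤ lam) ∧
      Order.succ lam ≤ lengthPlus ((D : Filter I).Product B) ∧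
      (lam ^ κ = lam → lengthPlus ((D : Filter I).Product B) = Order.succ lam) ∧
      cardinalUltraproduct D (fun i => lengthPlus (B i)) <
        lengthPlus ((D : Filter I).Product B) := by
  classical
  obtain ⟨W, hW⟩ := hD
  subst hI
  have hκ : #I < del := Order.succ_le_iff.1 hκdel
  have hI0 : #I ≠ 0 := by
    obtain ⟨i, -⟩ := D.nonempty_of_mem Filter.univ_mem
    exact mk_ne_zero_iff.2 ⟨i⟩
  have hdel1 : 1 < del := (Cardinal.one_le_iff_ne_zero.2 hI0).trans_lt hκ
  have hdel0 : ℵ₀ ≤ del := by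
    rw [← hcof] at hdel1 ⊢
    exact Ordinal.aleph0_le_cof_iff.2 hdel1
  have hIinf : ℵ₀ ≤ #I := by
    by_contra h
    exact (hdel0.trans hdel).not_gt (power_lt_aleph0 (natCast_lt_aleph0 (n := 2)) (not_le.1 h))
  have hlam : ℵ₀ < lam := (hIinf.trans_lt hκ).trans hsing
  have hcof' : ℵ₀ < lam.ord.cof := by rw [hcof]; exact hIinf.trans_lt hκ
  have hmkL : #lam.ord.ToType = lam := by simp
  have hcofL : Order.cof lam.ord.ToType = del := by rw [Ordinal.cof_toType, hcof]
  obtain ⟨S, hS, hScard⟩ := Order.exists_cof_eq lam.ord.ToType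
  have hSdel : #S = del := hScard.trans hcofL
  obtain ⟨x⟩ : Nonempty (S ↪ Set I) := by
    rw [← Cardinal.le_def, mk_set, hSdel]
    exact hdel
  -- The summand `ℕ` makes every `T a` infinite, as the interval algebra and the encoding require.
  let T : S → Type u := fun a => ℕ ⊕ₗ Set.Iio a.1
  have hTinf : ∀ a, Infinite (T a) := fun a => Sum.infinite_of_left
  have hT : ∀ a, #(T a) < lam := by
    intro a
    change #(ℕ ⊕ Set.Iio a.1) < lam
    rw [mk_sum, lift_uzero, mk_nat, lift_aleph0]
    exact add_lt_of_lt hlam.le hlam ((mk_Iio_lt a.1 (by simp)).trans_eq hmkL)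
  choose E instE f hf hf' hE using fun a => exists_booleanAlgebra_strictMono (T a)
  choose enc henc using fun a => exists_encoding hW (T a)
  let cls : ∀ i, S → Set (W i) := fun i a => {w | w.1 ∈ x a}
  have hcls : ∀ a a', a ≠ a' → ∀ᶠ i in D, cls i a ≠ cls i a' := by
    intro a a' h
    have hne : (fun ζ => ζ ∈ x a) ≠ fun ζ => ζ ∈ x a' := fun h' =>
      h (x.injective (Set.ext fun ζ => iff_of_eq (congrFun h' ζ)))
    filter_upwards [eventually_restrict_ne hW hne] with i hi h'
    exact hi (funext fun w => propext (Set.ext_iff.1 h' w))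
  -- Any linear order of the classes would do; no coherence between different `i` is needed.
  let ord : ∀ i, LinearOrder (Set (W i)) := fun i => linearOrderOfSTO WellOrderingRel
  have hElt : ∀ a, #(E a) < lam := fun a => (hE a).trans_lt (hT a)
  have hB : ∀ i, #(weakProduct E (cls i)) ≤ lam := fun i =>
    mk_weakProduct_le hlam (hSdel.le.trans hsing.le) hElt
  obtain ⟨A, hA, hAcard⟩ := exists_chain_ultraproduct D cls hcls f hf hf' enc henc
  have hAle : lam ^ #I ≤ #A := by
    rw [hAcard]
    refine (congrArg (· ^ #I) hmkL).ge.trans ?_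
    exact power_le_mk_sigma (hκ.trans_eq hcofL.symm) hS
      fun a => ⟨fun t => toLex (Sum.inr t), fun s t h => Sum.inr_injective (toLex.injective h)⟩
  have hlen : ∀ i, lengthPlus (weakProduct E (cls i)) ≤ lam := fun i =>
    lengthPlus_le fun A hA => mk_chain_weakProduct_lt hcof' hElt A hA
  have hlow : Order.succ (lam ^ #I) ≤
      lengthPlus ((D : Filter I).Product fun i => weakProduct E (cls i)) :=
    (Order.succ_le_succ hAle).trans (succ_mk_le_lengthPlus hA)
  have hlow' := (Order.succ_le_succ (self_le_power lam (Cardinal.one_le_iff_ne_zero.2 hI0))).trans hlow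
  refine ⟨fun i => weakProduct E (cls i), fun i => inferInstance, hlen, hlow', fun hpow => ?_, ?_⟩
  · refine le_antisymm (lengthPlus_le fun A _ => Order.lt_succ_of_le ?_) hlow'
    exact (mk_set_le A).trans ((mk_ultraproduct_le D hB).trans hpow.le)
  · refine lt_of_le_of_lt ?_ (Order.succ_le_iff.1 hlow)
    exact mk_ultraproduct_le D fun i => (mk_out _).trans_le (hlen i)
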